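/- All graphs are finite and simple. For a graph $G$ and $X\subseteq V(G)$ let $G[X]$ denote the subgraph induced by $X$; let $\delta$ and $\Delta$ denote minimum and maximum degree (both read as $0$ for the graph without vertices), $\overline{G}$ the complement, $G+H$ the disjoint union and $pG$ the disjoint union of $p$ copies of $G$. A graph $G$ is *Maya-Tupi* if $V(G)$ can be partitioned into two (possibly empty) sets $A$ and $B$ such that $\delta(G[A])\ge |A|-2$ and $\Delta(G[B])\le 1$. The class of *cographs* is the smallest class of graphs, closed under isomorphism, that contains the one-vertex graph and is closed under finite disjoint unions and under complements. A graph is $\mathcal{F}$-*free* if it has no induced subgraph isomorphic to a member of $\mathcal{F}$. Let $\mathcal{F}_{\mathrm{cog}}$ be the family consisting of the ten graphs $3P_3$, $2P_3+K_3$, $P_3+2K_3$, $3K_3$, and $C_4+J$, $\mathrm{diamond}+J$, $K_4+J$ for $J\in\{P_3,K_3\}$, together with their complements, where $P_3$ is the path on three vertices and the diamond is $K_4$ minus one edge. **Corollary.** A cograph is Maya-Tupi if and only if it is $\mathcal{F}_{\mathrm{cog}}$-free. -/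

import Mathlib

open scoped SimpleGraph

universe u

namespace MayaTupi

section Partition

variable {V : Type u} [Fintype V]

open Classical in
/-- `(A, B)` is an MT-partition of `G`: `A` and `B` partition the vertex set (either may be empty),
`δ(G[A]) ≥ |A| - 2` and `Δ(G[B]) ≤ 1`. -/
def IsMTPartition (G : SimpleGraph V) (A B : Finset V) : Prop :=
  IsCompl A B ∧
    A.card ≤ (G.induce (A : Set V)).minDegree + 2 ∧
    (G.induce (B : Set V)).maxDegree ≤ 1

/-- A graph is Maya-Tupi if it has an MT-partition. -/
def IsMayaTupi (G : SimpleGraph V) : Prop :=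
  ∃ A B : Finset V, IsMTPartition G A B

end Partition

/-- The disjoint union of a family of graphs. -/
def disjointUnion {ι : Type} {V : ι → Type u} (G : ∀ i, SimpleGraph (V i)) :
    SimpleGraph (Σ i, V i) where
  Adj x y := ∃ (i : ι) (a b : V i), (G i).Adj a b ∧ x = ⟨i, a⟩ ∧ y = ⟨i, b⟩
  symm := ⟨fun _ _ ⟨i, a, b, h, hx, hy⟩ => ⟨i, b, a, h.symm, hy, hx⟩⟩
  loopless := ⟨by
    rintro x ⟨i, a, b, h, rfl, hy⟩
    cases hy
    exact (G i).irrefl h⟩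

/-- Cographs, the least isomorphism-closed class that contains the one-vertex graph and is closed
under finite disjoint unions and complements. (The empty union is allowed, so the graph without
vertices counts as a cograph.) -/
inductive IsCograph : {V : Type u} → SimpleGraph V → Prop
  | trivial {V : Type u} [Unique V] (G : SimpleGraph V) : IsCograph G
  | union {k : ℕ} {V : Fin k → Type u} (G : ∀ i, SimpleGraph (V i))
      (h : ∀ i, IsCograph (G i)) : IsCograph (disjointUnion G)
  | compl {V : Type u} (G : SimpleGraph V) (h : IsCograph G) : IsCograph Gᶜ
  | iso {V W : Type u} {G : SimpleGraph V} {H : SimpleGraph W} (e : G ≃g H)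
      (h : IsCograph G) : IsCograph H

/-- A graph together with its vertex set. -/
abbrev Graph : Type 1 := Σ W : Type, SimpleGraph W

/-- `G` has no induced subgraph isomorphic to a member of `F`. -/
def FamilyFree {V : Type u} (F : Set Graph) (G : SimpleGraph V) : Prop :=
  ∀ H ∈ F, ¬ H.2 ⊴ G

/-- The path on three vertices. -/
abbrev P3 : SimpleGraph (Fin 3) := SimpleGraph.pathGraph 3

/-- The triangle. -/
abbrev K3 : SimpleGraph (Fin 3) := ⊤

/-- The complete graph on four vertices. -/
abbrev K4 : SimpleGraph (Fin 4) := ⊤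

/-- The cycle on four vertices. -/
abbrev C4 : SimpleGraph (Fin 4) := SimpleGraph.cycleGraph 4

/-- The diamond: `K4` minus one edge. -/
abbrev diamond : SimpleGraph (Fin 4) := (⊤ : SimpleGraph (Fin 4)).deleteEdges {s(0, 1)}

/-- The ten disconnected members of the family of forbidden cographs. -/
def FcogBase : Set Graph :=
  { ⟨_, P3 ⊕g P3 ⊕g P3⟩, ⟨_, P3 ⊕g P3 ⊕g K3⟩, ⟨_, P3 ⊕g K3 ⊕g K3⟩, ⟨_, K3 ⊕g K3 ⊕g K3⟩,
    ⟨_, C4 ⊕g P3⟩, ⟨_, C4 ⊕g K3⟩,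
    ⟨_, diamond ⊕g P3⟩, ⟨_, diamond ⊕g K3⟩,
    ⟨_, K4 ⊕g P3⟩, ⟨_, K4 ⊕g K3⟩ }

/-- The family of forbidden cographs: the ten disconnected ones and their complements. -/
def Fcog : Set Graph :=
  FcogBase ∪ {H | ∃ J ∈ FcogBase, H = ⟨J.1, J.2ᶜ⟩}

end MayaTupi

/-! Call a not necessarily induced path on three vertices a cherry and a not necessarily induced
four-cycle a quad. The degree conditions say that `B` has no cherry and `A` none in the complement.
Classifying the induced graphs, P3 or K3 for a cherry and C4, diamond or K4 for a quad, turns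
freeness from the ten base graphs into the absence of three anticomplete cherries and of a quad
anticomplete to a cherry (`Obstructed`).

Necessity holds for every graph: `A` must meet each cherry, and an obstruction would then force a
cherry of the complement into `A` or leave one in `B`.

Sufficiency is induction along cograph splits. Everything is self-complementary, so only a split
without cross edges matters. A cherry-free side joins `B`. If both sides have cherries, each is
quad-free without two anticomplete cherries, so deleting at most one vertex destroys its cherries
(`exists_subsingleton_not_hasCherry_diff`). The deleted vertices form `A`; two vertices carry no
cherry. -/

namespace MayaTupi

/-! ### Cherries, quads, obstructions and splits -/

section Patterns

variable {V : Type*} {W : Type*}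

/-- `a` is adjacent to the distinct vertices `b` and `c`: an induced `P3` or `K3`. -/
def Cherry (G : SimpleGraph V) (a b c : V) : Prop :=
  G.Adj a b ∧ G.Adj a c ∧ b ≠ c

/-- A not necessarily induced four-cycle `a c b d`: an induced `C4`, diamond or `K4`. -/
def Quad (G : SimpleGraph V) (a b c d : V) : Prop :=
  a ≠ b ∧ c ≠ d ∧ G.Adj a c ∧ G.Adj a d ∧ G.Adj b c ∧ G.Adj b d

/-- `X` and `Y` are disjoint and no edge joins them. -/
def Anticomplete (G : SimpleGraph V) (X Y : Set V) : Prop :=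
  ∀ x ∈ X, ∀ y ∈ Y, x ≠ y ∧ ¬ G.Adj x y

/-- `X` contains a cherry. -/
def HasCherry (G : SimpleGraph V) (X : Set V) : Prop :=
  ∃ a ∈ X, ∃ b ∈ X, ∃ c ∈ X, Cherry G a b c

/-- `X` contains a four-cycle. -/
def HasQuad (G : SimpleGraph V) (X : Set V) : Prop :=
  ∃ a ∈ X, ∃ b ∈ X, ∃ c ∈ X, ∃ d ∈ X, Quad G a b c d

/-- `S` contains three pairwise anticomplete cherries, or a four-cycle anticomplete to a cherry. -/
def Obstructed (G : SimpleGraph V) (S : Set V) : Prop :=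
  (∃ X ⊆ S, ∃ Y ⊆ S, ∃ Z ⊆ S, HasCherry G X ∧ HasCherry G Y ∧ HasCherry G Z ∧
    Anticomplete G X Y ∧ Anticomplete G X Z ∧ Anticomplete G Y Z) ∨
  (∃ X ⊆ S, ∃ Y ⊆ S, HasQuad G X ∧ HasCherry G Y ∧ Anticomplete G X Y)

/-- `A` and `B` cover `S`, with `A` cherry-free in the complement and `B` cherry-free. -/
def Partitionable (G : SimpleGraph V) (S : Set V) : Prop :=
  ∃ A B : Set V, A ∪ B = S ∧ Disjoint A B ∧ ¬ HasCherry Gᶜ A ∧ ¬ HasCherry G B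

/-- Every set of at least two vertices splits into two parts with all or no edges between them. -/
def HereditarilySplits (G : SimpleGraph V) : Prop :=
  ∀ S : Set V, S.Nontrivial → ∃ X Y : Set V, X.Nonempty ∧ Y.Nonempty ∧ X ∪ Y = S ∧
    (Anticomplete G X Y ∨ Anticomplete Gᶜ X Y)

variable {G : SimpleGraph V} {H : SimpleGraph W} {S T X Y : Set V}

theorem HasCherry.mono (h : S ⊆ T) : HasCherry G S → HasCherry G T := by
  rintro ⟨a, ha, b, hb, c, hc, hh⟩
  exact ⟨a, h ha, b, h hb, c, h hc, hh⟩

theorem HasQuad.mono (h : S ⊆ T) : HasQuad G S → HasQuad G T := by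
  rintro ⟨a, ha, b, hb, c, hc, d, hd, hh⟩
  exact ⟨a, h ha, b, h hb, c, h hc, d, h hd, hh⟩

theorem Obstructed.mono (h : S ⊆ T) : Obstructed G S → Obstructed G T := by
  rintro (⟨X, hX, Y, hY, Z, hZ, hh⟩ | ⟨X, hX, Y, hY, hh⟩)
  · exact .inl ⟨X, hX.trans h, Y, hY.trans h, Z, hZ.trans h, hh⟩
  · exact .inr ⟨X, hX.trans h, Y, hY.trans h, hh⟩

theorem Anticomplete.symm (h : Anticomplete G X Y) : Anticomplete G Y X :=
  fun y hy x hx => ⟨(h x hx y hy).1.symm, fun e => (h x hx y hy).2 e.symm⟩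

theorem Anticomplete.mono {X' Y' : Set V} (h : Anticomplete G X Y) (hX : X' ⊆ X) (hY : Y' ⊆ Y) :
    Anticomplete G X' Y' :=
  fun x hx y hy => h x (hX hx) y (hY hy)

theorem Anticomplete.disjoint (h : Anticomplete G X Y) : Disjoint X Y :=
  Set.disjoint_left.2 fun x hx hy => (h x hx x hy).1 rfl

theorem Anticomplete.adj_of_compl (h : Anticomplete Gᶜ X Y) {x y : V} (hx : x ∈ X) (hy : y ∈ Y) :
    G.Adj x y := by
  obtain ⟨hne, hn⟩ := h x hx y hy
  by_contra hc
  exact hn ((SimpleGraph.compl_adj _ _ _).2 ⟨hne, hc⟩)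

theorem HasCherry.of_union (h : Anticomplete G X Y) (hc : HasCherry G (X ∪ Y)) :
    HasCherry G X ∨ HasCherry G Y := by
  obtain ⟨a, ha, b, hb, c, hc, hab, hac, hbc⟩ := hc
  rcases ha with ha | ha
  · exact .inl ⟨a, ha, b, hb.resolve_right fun hb => (h a ha b hb).2 hab,
      c, hc.resolve_right fun hc => (h a ha c hc).2 hac, hab, hac, hbc⟩
  · exact .inr ⟨a, ha, b, hb.resolve_left fun hb => (h b hb a ha).2 hab.symm,
      c, hc.resolve_left fun hc => (h c hc a ha).2 hac.symm, hab, hac, hbc⟩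

theorem HasCherry.map (f : H ↪g G) {S : Set W} : HasCherry H S → HasCherry G (f '' S) := by
  rintro ⟨a, ha, b, hb, c, hc, hab, hac, hbc⟩
  exact ⟨f a, ⟨a, ha, rfl⟩, f b, ⟨b, hb, rfl⟩, f c, ⟨c, hc, rfl⟩, f.map_rel_iff.2 hab,
    f.map_rel_iff.2 hac, f.injective.ne hbc⟩

theorem HasQuad.map (f : H ↪g G) {S : Set W} : HasQuad H S → HasQuad G (f '' S) := by
  rintro ⟨a, ha, b, hb, c, hc, d, hd, hab, hcd, h1, h2, h3, h4⟩
  exact ⟨f a, ⟨a, ha, rfl⟩, f b, ⟨b, hb, rfl⟩, f c, ⟨c, hc, rfl⟩, f d, ⟨d, hd, rfl⟩,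
    f.injective.ne hab, f.injective.ne hcd, f.map_rel_iff.2 h1, f.map_rel_iff.2 h2,
    f.map_rel_iff.2 h3, f.map_rel_iff.2 h4⟩

theorem Anticomplete.map (f : H ↪g G) {X Y : Set W} (h : Anticomplete H X Y) :
    Anticomplete G (f '' X) (f '' Y) := by
  rintro _ ⟨x, hx, rfl⟩ _ ⟨y, hy, rfl⟩
  exact ⟨f.injective.ne (h x hx y hy).1, fun e => (h x hx y hy).2 (f.map_rel_iff.1 e)⟩

theorem Obstructed.map (f : H ↪g G) : Obstructed H Set.univ → Obstructed G Set.univ := by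
  rintro (⟨X, -, Y, -, Z, -, hX, hY, hZ, hXY, hXZ, hYZ⟩ | ⟨X, -, Y, -, hX, hY, hXY⟩)
  · exact .inl ⟨_, Set.subset_univ _, _, Set.subset_univ _, _, Set.subset_univ _, hX.map f,
      hY.map f, hZ.map f, hXY.map f, hXZ.map f, hYZ.map f⟩
  · exact .inr ⟨_, Set.subset_univ _, _, Set.subset_univ _, hX.map f, hY.map f, hXY.map f⟩

theorem Partitionable.compl (h : Partitionable G S) : Partitionable Gᶜ S := by
  obtain ⟨A, B, hAB, hd, hA, hB⟩ := h
  exact ⟨B, A, by rw [Set.union_comm, hAB], hd.symm, by rwa [compl_compl], hA⟩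

theorem HereditarilySplits.compl (h : HereditarilySplits G) : HereditarilySplits Gᶜ := by
  intro S hS
  obtain ⟨X, Y, hX, hY, hXY, hh⟩ := h S hS
  exact ⟨X, Y, hX, hY, hXY, by rw [compl_compl]; exact hh.symm⟩

/-- The first part of a split is a proper subset. -/
theorem Anticomplete.ssubset_union (h : Anticomplete G X Y) (hY : Y.Nonempty) :
    X ⊂ X ∪ Y := by
  refine ⟨Set.subset_union_left, fun hs => ?_⟩
  obtain ⟨y, hy⟩ := hY
  exact (h y (hs (.inr hy)) y hy).1 rfl

/-- Adding a cherry-free part without edges to the rest keeps a set partitionable. -/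
theorem Partitionable.union (hX : Partitionable G X) (h : Anticomplete G X Y)
    (hY : ¬ HasCherry G Y) : Partitionable G (X ∪ Y) := by
  obtain ⟨A, B, rfl, hd, hA, hB⟩ := hX
  refine ⟨A, B ∪ Y, (Set.union_assoc _ _ _).symm, ?_, hA, fun hch => ?_⟩
  · exact Set.disjoint_union_right.2 ⟨hd, h.disjoint.mono_left Set.subset_union_left⟩
  · exact (hch.of_union (h.mono Set.subset_union_right subset_rfl)).elim hB hY

end Patterns

/-! ### Unobstructed cographs have a partition -/

section Sufficiency

variable {V : Type*} [Finite V] {G : SimpleGraph V}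

/-- A set without four-cycles and without two anticomplete cherries loses all its cherries on
removing a suitable vertex. -/
theorem exists_subsingleton_not_hasCherry_diff (hG : HereditarilySplits G) (S : Set V)
    (hq : ¬ HasQuad G S)
    (hc : ∀ X ⊆ S, ∀ Y ⊆ S, Anticomplete G X Y → HasCherry G X → ¬ HasCherry G Y) :
    ∃ A ⊆ S, A.Subsingleton ∧ ¬ HasCherry G (S \ A) := by
  induction S using WellFoundedLT.induction with
  | ind S ih =>
  by_cases hS : S.Nontrivial
  · obtain ⟨X, Y, hX, hY, rfl, h | h⟩ := hG S hS
    · have key : ∀ X Y : Set V, X ⊂ X ∪ Y → Anticomplete G X Y → ¬ HasQuad G (X ∪ Y) →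
          (∀ X' ⊆ X ∪ Y, ∀ Y' ⊆ X ∪ Y, Anticomplete G X' Y' → HasCherry G X' →
            ¬ HasCherry G Y') →
          (∀ T < X ∪ Y, ¬ HasQuad G T → (∀ X ⊆ T, ∀ Y ⊆ T, Anticomplete G X Y →
            HasCherry G X → ¬ HasCherry G Y) →
            ∃ A ⊆ T, A.Subsingleton ∧ ¬ HasCherry G (T \ A)) → ¬ HasCherry G Y →
          ∃ A ⊆ X ∪ Y, A.Subsingleton ∧ ¬ HasCherry G ((X ∪ Y) \ A) := by
        intro X Y hlt h hq hc ih hYc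
        obtain ⟨A, hA, hs, hn⟩ := ih X hlt (fun q => hq (q.mono hlt.1))
          (fun X' hX' Y' hY' => hc X' (hX'.trans hlt.1) Y' (hY'.trans hlt.1))
        refine ⟨A, hA.trans hlt.1, hs, fun hch => ?_⟩
        rw [Set.union_sdiff_distrib] at hch
        rcases hch.of_union (h.mono Set.sdiff_subset Set.sdiff_subset) with hh | hh
        · exact hn hh
        · exact hYc (hh.mono Set.sdiff_subset)
      -- The two sides are anticomplete, so at most one has a cherry, and induction on the other
      -- side suffices.
      by_cases hYc : HasCherry G Y
      · have hXc : ¬ HasCherry G X :=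
          fun hXc => hc X Set.subset_union_left Y Set.subset_union_right h hXc hYc
        have := h.symm.ssubset_union hX
        rw [Set.union_comm] at hq hc ih ⊢
        exact key Y X this h.symm hq hc ih hXc
      · exact key X Y (h.ssubset_union hY) h hq hc ih hYc
    · have key : ∀ X Y : Set V, X.Nonempty → X.Subsingleton → Anticomplete Gᶜ X Y →
          ¬ HasQuad G (X ∪ Y) →
          ∃ A ⊆ X ∪ Y, A.Subsingleton ∧ ¬ HasCherry G ((X ∪ Y) \ A) := by
        intro X Y hX hXs h hq
        -- The vertex of `X` is joined to all of `Y`; with the centre of a surviving cherry it forms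
        -- one diagonal pair of a quad, the ends being the other.
        refine ⟨X, Set.subset_union_left, hXs, fun hch => hq ?_⟩
        obtain ⟨v, hv⟩ := hX
        obtain ⟨a, ha, b, hb, c, hc, hab, hac, hbc⟩ := hch
        have mem : ∀ z ∈ (X ∪ Y) \ X, z ∈ Y := fun z hz => hz.1.resolve_left hz.2
        exact ⟨v, .inl hv, a, ha.1, b, hb.1, c, hc.1, (h v hv a (mem a ha)).1, hbc,
          h.adj_of_compl hv (mem b hb), h.adj_of_compl hv (mem c hc), hab, hac⟩
      rcases X.subsingleton_or_nontrivial with hXs | ⟨a, ha, b, hb, hab⟩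
      · exact key X Y hX hXs h hq
      rcases Y.subsingleton_or_nontrivial with hYs | ⟨c, hc, d, hd, hcd⟩
      · rw [Set.union_comm] at hq ⊢
        exact key Y X hY hYs h.symm hq
      -- Two vertices on each side of a join already span a quad.
      · exact (hq ⟨a, .inl ha, b, .inl hb, c, .inr hc, d, .inr hd, hab, hcd, h.adj_of_compl ha hc,
          h.adj_of_compl ha hd, h.adj_of_compl hb hc, h.adj_of_compl hb hd⟩).elim
  · refine ⟨S, subset_rfl, Set.not_nontrivial_iff.1 hS, ?_⟩
    rintro ⟨a, ha, -⟩
    exact ha.2 ha.1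

theorem partitionable_union_of_anticomplete (hG : HereditarilySplits G) {X Y : Set V}
    (h : Anticomplete G X Y) (ho : ¬ Obstructed G (X ∪ Y))
    (hX : Partitionable G X) (hY : Partitionable G Y) : Partitionable G (X ∪ Y) := by
  by_cases hYc : HasCherry G Y
  swap
  · exact hX.union h hYc
  by_cases hXc : HasCherry G X
  swap
  · rw [Set.union_comm]
    exact hY.union h.symm hXc
  have lX : X ⊆ X ∪ Y := Set.subset_union_left
  have lY : Y ⊆ X ∪ Y := Set.subset_union_right
  obtain ⟨A, hA, hAs, hAn⟩ := exists_subsingleton_not_hasCherry_diff hG X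
    (fun q => ho (.inr ⟨X, lX, Y, lY, q, hYc, h⟩))
    (fun X₁ h₁ X₂ h₂ ha c₁ c₂ => ho (.inl ⟨X₁, h₁.trans lX, X₂, h₂.trans lX, Y, lY, c₁, c₂, hYc,
      ha, h.mono h₁ subset_rfl, h.mono h₂ subset_rfl⟩))
  obtain ⟨B, hB, hBs, hBn⟩ := exists_subsingleton_not_hasCherry_diff hG Y
    (fun q => ho (.inr ⟨Y, lY, X, lX, q, hXc, h.symm⟩))
    (fun Y₁ h₁ Y₂ h₂ ha c₁ c₂ => ho (.inl ⟨X, lX, Y₁, h₁.trans lY, Y₂, h₂.trans lY, hXc, c₁, c₂,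
      h.mono subset_rfl h₁, h.mono subset_rfl h₂, ha⟩))
  refine ⟨A ∪ B, (X \ A) ∪ (Y \ B), ?_, ?_, ?_, ?_⟩
  · rw [Set.union_union_union_comm, Set.union_sdiff_cancel hA, Set.union_sdiff_cancel hB]
  · simp only [Set.disjoint_union_left, Set.disjoint_union_right]
    exact ⟨⟨Set.disjoint_sdiff_right, (h.disjoint.mono_right hB).symm.mono_right Set.sdiff_subset⟩,
      h.disjoint.mono hA Set.sdiff_subset, Set.disjoint_sdiff_right⟩
  -- Pigeonhole: a cherry has three distinct vertices, `A ∪ B` at most two.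
  · rintro ⟨a, ha, b, hb, c, hc, hab, hac, hbc⟩
    have e1 := hab.ne
    have e2 := hac.ne
    rcases ha with ha | ha <;> rcases hb with hb | hb <;> rcases hc with hc | hc <;>
      first
        | exact e1 (hAs ha hb) | exact e1 (hBs ha hb) | exact e2 (hAs ha hc)
        | exact e2 (hBs ha hc) | exact hbc (hAs hb hc) | exact hbc (hBs hb hc)
  · intro hch
    exact (hch.of_union (h.mono Set.sdiff_subset Set.sdiff_subset)).elim hAn hBn

theorem partitionable_of_not_obstructed (S : Set V) (hG : HereditarilySplits G)
    (h₁ : ¬ Obstructed G S) (h₂ : ¬ Obstructed Gᶜ S) : Partitionable G S := by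
  induction S using WellFoundedLT.induction with
  | ind S ih =>
  by_cases hS : S.Nontrivial
  · obtain ⟨X, Y, hX, hY, rfl, h⟩ := hG S hS
    have sX : X ⊂ X ∪ Y := h.elim (·.ssubset_union hY) (·.ssubset_union hY)
    have sY : Y ⊂ X ∪ Y := by
      rw [Set.union_comm]
      exact h.elim (·.symm.ssubset_union hX) (·.symm.ssubset_union hX)
    have pX := ih X sX (fun o => h₁ (o.mono sX.1)) (fun o => h₂ (o.mono sX.1))
    have pY := ih Y sY (fun o => h₁ (o.mono sY.1)) (fun o => h₂ (o.mono sY.1))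
    rcases h with h | h
    · exact partitionable_union_of_anticomplete hG h h₁ pX pY
    -- A join is an anticomplete split of the complement, where the two obstruction hypotheses trade
    -- places.
    · rw [← compl_compl G]
      exact (partitionable_union_of_anticomplete hG.compl h h₂ pX.compl pY.compl).compl
  · refine ⟨∅, S, Set.empty_union S, Set.empty_disjoint S, ?_, ?_⟩
    · rintro ⟨a, ha, -⟩
      exact ha
    · rintro ⟨a, -, b, hb, c, hc, -, -, hbc⟩
      exact hbc (Set.not_nontrivial_iff.1 hS hb hc)

end Sufficiency

/-! ### Obstructions exclude a partition -/

section Necessity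

variable {V : Type*} {G : SimpleGraph V}

theorem not_obstructed_of_partitionable (h : Partitionable G Set.univ) :
    ¬ Obstructed G Set.univ := by
  obtain ⟨A, B, hAB, hd, hA, hB⟩ := h
  have mem : ∀ x, x ∉ A → x ∈ B := fun x hx => by
    have : x ∈ A ∪ B := hAB ▸ Set.mem_univ x
    exact this.resolve_left hx
  have meets : ∀ X, HasCherry G X → ∃ x ∈ X, x ∈ A := by
    intro X hX
    by_contra! hn
    exact hB (hX.mono fun x hx => mem x (hn x hx))
  rintro (⟨X, -, Y, -, Z, -, hX, hY, hZ, hXY, hXZ, hYZ⟩ | ⟨X, -, Y, -, hX, hY, hXY⟩)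
  · obtain ⟨x, hx, hxA⟩ := meets X hX
    obtain ⟨y, hy, hyA⟩ := meets Y hY
    obtain ⟨z, hz, hzA⟩ := meets Z hZ
    exact hA ⟨x, hxA, y, hyA, z, hzA, (SimpleGraph.compl_adj _ _ _).2 (hXY x hx y hy),
      (SimpleGraph.compl_adj _ _ _).2 (hXZ x hx z hz), (hYZ y hy z hz).1⟩
  · obtain ⟨y, hy, hyA⟩ := meets Y hY
    -- Two vertices of `X` in `A` would form a cherry of the complement centred at `y`.
    have uniq : ∀ p ∈ X, ∀ q ∈ X, p ≠ q → p ∈ A → q ∈ B := fun p hp q hq hpq hpA =>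
      mem q fun hqA => hA ⟨y, hyA, p, hpA, q, hqA,
        (SimpleGraph.compl_adj _ _ _).2 (hXY.symm y hy p hp),
        (SimpleGraph.compl_adj _ _ _).2 (hXY.symm y hy q hq), hpq⟩
    obtain ⟨a, ha, b, hb, c, hc, d, hd, hab, hcd, hac, had, hbc, hbd⟩ := hX
    -- `A` contains at most one vertex of the quad, and any three vertices of a quad carry a cherry.
    -- The final case also covers `b ∈ A`.
    by_cases h1 : a ∈ A
    · exact hB ⟨b, uniq a ha b hb hab h1, c, uniq a ha c hc hac.ne h1, d,
        uniq a ha d hd had.ne h1, hbc, hbd, hcd⟩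
    by_cases h2 : c ∈ A
    · exact hB ⟨d, uniq c hc d hd hcd h2, a, mem a h1, b, uniq c hc b hb hbc.ne.symm h2,
        had.symm, hbd.symm, hab⟩
    by_cases h3 : d ∈ A
    · exact hB ⟨c, mem c h2, a, mem a h1, b, uniq d hd b hb hbd.ne.symm h3, hac.symm,
        hbc.symm, hab⟩
    exact hB ⟨a, mem a h1, c, mem c h2, d, mem d h3, hac, had, hcd⟩

end Necessity

/-! ### Degree conditions as absence of cherries -/

section Degrees

variable {V : Type*}

theorem hasCherry_univ_iff [Fintype V] (G : SimpleGraph V) [DecidableRel G.Adj] :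
    HasCherry G Set.univ ↔ ∃ v, 1 < G.degree v := by
  simp only [HasCherry, Cherry, Set.mem_univ, true_and, ← SimpleGraph.card_neighborFinset_eq_degree,
    Finset.one_lt_card, SimpleGraph.mem_neighborFinset]
  exact exists_congr fun v => ⟨fun ⟨b, c, h1, h2, h3⟩ => ⟨b, h1, c, h2, h3⟩,
    fun ⟨b, h1, c, h2, h3⟩ => ⟨b, c, h1, h2, h3⟩⟩

theorem hasCherry_induce_iff (G : SimpleGraph V) (S : Set V) :
    HasCherry (G.induce S) Set.univ ↔ HasCherry G S := by
  constructor
  · rintro ⟨a, -, b, -, c, -, h1, h2, h3⟩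
    exact ⟨a, a.2, b, b.2, c, c.2, h1, h2, fun h => h3 (Subtype.ext h)⟩
  · rintro ⟨a, ha, b, hb, c, hc, h1, h2, h3⟩
    exact ⟨⟨a, ha⟩, trivial, ⟨b, hb⟩, trivial, ⟨c, hc⟩, trivial, h1, h2,
      fun h => h3 (congrArg Subtype.val h)⟩

theorem compl_induce (G : SimpleGraph V) (S : Set V) : (G.induce S)ᶜ = Gᶜ.induce S := by
  ext a b
  simp [Subtype.ext_iff]

theorem maxDegree_le_one_iff [Fintype V] (G : SimpleGraph V) [DecidableRel G.Adj] :
    G.maxDegree ≤ 1 ↔ ¬ HasCherry G Set.univ := by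
  rw [hasCherry_univ_iff]
  push Not
  exact ⟨fun h v => (G.degree_le_maxDegree v).trans h, fun h => G.maxDegree_le_of_forall_degree_le 1 h⟩

theorem card_le_minDegree_add_two_iff [Fintype V] [DecidableEq V] (G : SimpleGraph V)
    [DecidableRel G.Adj] :
    Fintype.card V ≤ G.minDegree + 2 ↔ ¬ HasCherry Gᶜ Set.univ := by
  rw [hasCherry_univ_iff]
  push Not
  simp only [SimpleGraph.degree_compl]
  constructor
  · intro h v
    have := G.minDegree_le_degree v
    omega
  · intro h
    rcases isEmpty_or_nonempty V with hV | hV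
    · simp
    · obtain ⟨v, hv⟩ := G.exists_minimal_degree_vertex
      have := h v
      omega

theorem isMayaTupi_iff_partitionable [Fintype V] (G : SimpleGraph V) :
    IsMayaTupi G ↔ Partitionable G Set.univ := by
  classical
  have hA : ∀ A : Finset V, A.card ≤ (G.induce (A : Set V)).minDegree + 2 ↔
      ¬ HasCherry Gᶜ (A : Set V) := fun A => by
    rw [← hasCherry_induce_iff, ← compl_induce, ← card_le_minDegree_add_two_iff]
    simp
  have hB : ∀ B : Finset V, (G.induce (B : Set V)).maxDegree ≤ 1 ↔ ¬ HasCherry G (B : Set V) :=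
    fun B => by rw [← hasCherry_induce_iff, ← maxDegree_le_one_iff]
  constructor
  · rintro ⟨A, B, hc, h1, h2⟩
    refine ⟨A, B, ?_, Finset.disjoint_coe.2 hc.disjoint, (hA A).1 ?_, (hB B).1 ?_⟩
    · rw [← Finset.coe_union, ← Finset.sup_eq_union, hc.sup_eq_top]
      simp
    · convert h1
    · convert h2
  · rintro ⟨A, B, hu, hd, h1, h2⟩
    refine ⟨A.toFinset, B.toFinset, ⟨?_, ?_⟩, ?_, ?_⟩
    · simpa using hd
    · rw [codisjoint_iff, Finset.sup_eq_union, ← Finset.coe_inj]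
      simpa using hu
    · convert (hA A.toFinset).2 (by simpa using h1)
    · convert (hB B.toFinset).2 (by simpa using h2)

end Degrees

/-! ### Cographs split hereditarily -/

section Cographs

theorem exists_split_image {V W : Type*} {G : SimpleGraph V} {H : SimpleGraph W}
    (hG : HereditarilySplits G) (e : G ↪g H) {S : Set V} (hS : S.Nontrivial) :
    ∃ X Y : Set W, X.Nonempty ∧ Y.Nonempty ∧ X ∪ Y = e '' S ∧
      (Anticomplete H X Y ∨ Anticomplete Hᶜ X Y) := by
  obtain ⟨X, Y, hX, hY, rfl, h⟩ := hG S hS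
  exact ⟨e '' X, e '' Y, hX.image e, hY.image e, (Set.image_union _ _ _).symm,
    h.imp (·.map e) (·.map (SimpleGraph.Embedding.complEquiv e))⟩

/-- The embedding of a graph of the family into the disjoint union. -/
def embeddingDisjointUnion {ι : Type} {V : ι → Type u} (G : ∀ i, SimpleGraph (V i)) (i : ι) :
    G i ↪g disjointUnion G where
  toFun := Sigma.mk i
  inj' := sigma_mk_injective
  map_rel_iff' := by
    intro a b
    constructor
    · rintro ⟨j, a', b', h, ha, hb⟩
      cases ha
      cases hb
      exact h
    · exact fun h => ⟨i, a, b, h, rfl, rfl⟩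

theorem fst_eq_of_disjointUnion_adj {ι : Type} {V : ι → Type u} {G : ∀ i, SimpleGraph (V i)}
    {x y : Σ i, V i} (h : (disjointUnion G).Adj x y) : x.1 = y.1 := by
  obtain ⟨i, a, b, -, rfl, rfl⟩ := h
  rfl

theorem HereditarilySplits.disjointUnion {ι : Type} {V : ι → Type u} {G : ∀ i, SimpleGraph (V i)}
    (h : ∀ i, HereditarilySplits (G i)) : HereditarilySplits (disjointUnion G) := by
  intro S hS
  obtain ⟨p, hp, -⟩ := id hS
  by_cases hq : ∃ q ∈ S, q.1 ≠ p.1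
  · obtain ⟨q, hq, hqp⟩ := hq
    -- Separate one summand from the rest; a set inside a single summand inherits that summand's
    -- split.
    refine ⟨{s ∈ S | s.1 = p.1}, {s ∈ S | s.1 ≠ p.1}, ⟨p, hp, rfl⟩, ⟨q, hq, hqp⟩, ?_, .inl ?_⟩
    · ext s
      by_cases hs : s.1 = p.1 <;> simp [hs]
    · rintro x ⟨-, hx⟩ y ⟨-, hy⟩
      exact ⟨fun e => hy (e ▸ hx), fun e => hy (fst_eq_of_disjointUnion_adj e ▸ hx)⟩
  · push Not at hq
    have hr : S ⊆ Set.range (embeddingDisjointUnion G p.1) := by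
      rintro ⟨i, a⟩ hs
      obtain rfl : i = p.1 := hq _ hs
      exact ⟨a, rfl⟩
    obtain ⟨T, rfl⟩ := Set.subset_range_iff_exists_image_eq.1 hr
    exact exists_split_image (h p.1) _ (Set.nontrivial_of_image _ _ hS)

theorem IsCograph.hereditarilySplits {V : Type u} {G : SimpleGraph V} (h : IsCograph G) :
    HereditarilySplits G := by
  induction h with
  | trivial G =>
    intro S hS
    exact (Set.not_nontrivial_iff.2 Set.subsingleton_of_subsingleton hS).elim
  | union G h ih => exact .disjointUnion ih
  | compl G h ih => exact ih.compl
  | iso e h ih =>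
    intro S hS
    have hr : S ⊆ Set.range e.toEmbedding := fun s _ => e.surjective s
    obtain ⟨T, rfl⟩ := Set.subset_range_iff_exists_image_eq.1 hr
    exact exists_split_image ih e.toEmbedding (Set.nontrivial_of_image _ _ hS)

end Cographs

/-! ### The forbidden family and obstructions -/

section Family

variable {V : Type*} {G : SimpleGraph V}

theorem hasCherry_P3 : HasCherry P3 Set.univ :=
  ⟨1, trivial, 0, trivial, 2, trivial, by simp [Cherry, SimpleGraph.pathGraph_adj]⟩

theorem hasCherry_K3 : HasCherry K3 Set.univ :=
  ⟨1, trivial, 0, trivial, 2, trivial, by simp [Cherry]⟩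

theorem hasQuad_C4 : HasQuad C4 Set.univ :=
  ⟨0, trivial, 2, trivial, 1, trivial, 3, trivial, by
    simp only [Quad, SimpleGraph.cycleGraph_adj]; decide⟩

theorem hasQuad_diamond : HasQuad diamond Set.univ :=
  ⟨0, trivial, 1, trivial, 2, trivial, 3, trivial, by
    simp [Quad]⟩

theorem hasQuad_K4 : HasQuad K4 Set.univ :=
  ⟨0, trivial, 1, trivial, 2, trivial, 3, trivial, by simp [Quad]⟩

theorem anticomplete_sum {W₁ W₂ : Type*} (H₁ : SimpleGraph W₁) (H₂ : SimpleGraph W₂) :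
    Anticomplete (H₁ ⊕g H₂) (Set.range Sum.inl) (Set.range Sum.inr) := by
  rintro _ ⟨x, rfl⟩ _ ⟨y, rfl⟩
  exact ⟨by simp, by simp⟩

theorem hasCherry_sum_inl {W₁ W₂ : Type*} {H₁ : SimpleGraph W₁} (H₂ : SimpleGraph W₂)
    (h : HasCherry H₁ Set.univ) : HasCherry (H₁ ⊕g H₂) (Set.range Sum.inl) := by
  simpa [Set.image_univ] using h.map (SimpleGraph.Embedding.sumInl (G := H₁) (H := H₂))

theorem hasCherry_sum_inr {W₁ W₂ : Type*} (H₁ : SimpleGraph W₁) {H₂ : SimpleGraph W₂}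
    (h : HasCherry H₂ Set.univ) : HasCherry (H₁ ⊕g H₂) (Set.range Sum.inr) := by
  simpa [Set.image_univ] using h.map (SimpleGraph.Embedding.sumInr (G := H₁) (H := H₂))

theorem obstructed_sum_of_hasQuad {W₁ W₂ : Type*} {H₁ : SimpleGraph W₁} {H₂ : SimpleGraph W₂}
    (h₁ : HasQuad H₁ Set.univ) (h₂ : HasCherry H₂ Set.univ) :
    Obstructed (H₁ ⊕g H₂) Set.univ := by
  refine .inr ⟨_, Set.subset_univ _, _, Set.subset_univ _, ?_, hasCherry_sum_inr H₁ h₂,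
    anticomplete_sum _ _⟩
  simpa [Set.image_univ] using h₁.map (SimpleGraph.Embedding.sumInl (G := H₁) (H := H₂))

theorem obstructed_sum_sum {W₁ W₂ W₃ : Type*} {H₁ : SimpleGraph W₁} {H₂ : SimpleGraph W₂}
    {H₃ : SimpleGraph W₃} (h₁ : HasCherry H₁ Set.univ) (h₂ : HasCherry H₂ Set.univ)
    (h₃ : HasCherry H₃ Set.univ) : Obstructed (H₁ ⊕g H₂ ⊕g H₃) Set.univ := by
  let e : H₁ ⊕g H₂ ↪g H₁ ⊕g H₂ ⊕g H₃ := SimpleGraph.Embedding.sumInl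
  have he : ∀ S, e '' S ⊆ Set.range Sum.inl := by
    rintro S _ ⟨x, -, rfl⟩
    exact ⟨x, rfl⟩
  have h := anticomplete_sum (H₁ ⊕g H₂) H₃
  exact .inl ⟨_, Set.subset_univ _, _, Set.subset_univ _, _, Set.subset_univ _,
    (hasCherry_sum_inl H₂ h₁).map e, (hasCherry_sum_inr H₁ h₂).map e, hasCherry_sum_inr _ h₃,
    (anticomplete_sum H₁ H₂).map e, h.mono (he _) subset_rfl, h.mono (he _) subset_rfl⟩

theorem obstructed_of_mem_FcogBase {H : Graph} (h : H ∈ FcogBase) : Obstructed H.2 Set.univ := by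
  rcases h with rfl | rfl | rfl | rfl | rfl | rfl | rfl | rfl | rfl | rfl
  · exact obstructed_sum_sum hasCherry_P3 hasCherry_P3 hasCherry_P3
  · exact obstructed_sum_sum hasCherry_P3 hasCherry_P3 hasCherry_K3
  · exact obstructed_sum_sum hasCherry_P3 hasCherry_K3 hasCherry_K3
  · exact obstructed_sum_sum hasCherry_K3 hasCherry_K3 hasCherry_K3
  · exact obstructed_sum_of_hasQuad hasQuad_C4 hasCherry_P3
  · exact obstructed_sum_of_hasQuad hasQuad_C4 hasCherry_K3
  · exact obstructed_sum_of_hasQuad hasQuad_diamond hasCherry_P3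
  · exact obstructed_sum_of_hasQuad hasQuad_diamond hasCherry_K3
  · exact obstructed_sum_of_hasQuad hasQuad_K4 hasCherry_P3
  · exact obstructed_sum_of_hasQuad hasQuad_K4 hasCherry_K3

/-- An embedding checked on the pairs of vertices in increasing order. -/
def embeddingOfAdjIff {n : ℕ} {H : SimpleGraph (Fin n)} (f : Fin n → V)
    (h : ∀ i j, i < j → f i ≠ f j ∧ (G.Adj (f i) (f j) ↔ H.Adj i j)) : H ↪g G where
  toFun := f
  inj' := by
    intro i j hij
    rcases lt_trichotomy i j with hlt | rfl | hlt
    · exact ((h i j hlt).1 hij).elim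
    · rfl
    · exact ((h j i hlt).1 hij.symm).elim
  map_rel_iff' := by
    intro i j
    change G.Adj (f i) (f j) ↔ H.Adj i j
    rcases lt_trichotomy i j with hlt | rfl | hlt
    · exact (h i j hlt).2
    · simp
    · rw [G.adj_comm, H.adj_comm]
      exact (h j i hlt).2

theorem HasCherry.exists_embedding {X : Set V} (h : HasCherry G X) :
    (∃ f : P3 ↪g G, Set.range f ⊆ X) ∨ (∃ f : K3 ↪g G, Set.range f ⊆ X) := by
  obtain ⟨a, ha, b, hb, c, hc, hab, hac, hbc⟩ := h
  -- The centre `a` goes to position 1, the middle of `P3`.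
  have hm : Set.range ![b, a, c] ⊆ X := by
    rintro _ ⟨i, rfl⟩
    fin_cases i <;> assumption
  by_cases h : G.Adj b c
  · refine .inr ⟨embeddingOfAdjIff ![b, a, c] ?_, hm⟩
    intro i j hij
    fin_cases i <;> fin_cases j <;> simp_all [hab.ne.symm, hac.ne, hab.symm]
  · refine .inl ⟨embeddingOfAdjIff ![b, a, c] ?_, hm⟩
    intro i j hij
    fin_cases i <;> fin_cases j <;>
      simp_all [hab.ne.symm, hac.ne, hab.symm, SimpleGraph.pathGraph_adj]

theorem exists_diamond_embedding {X : Set V} {a b c d : V} (ha : a ∈ X) (hb : b ∈ X) (hc : c ∈ X)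
    (hd : d ∈ X) (h : Quad G a b c d) (h₁ : ¬ G.Adj a b) (h₂ : G.Adj c d) :
    ∃ f : diamond ↪g G, Set.range f ⊆ X := by
  obtain ⟨hab, hcd, hac, had, hbc, hbd⟩ := h
  refine ⟨embeddingOfAdjIff ![a, b, c, d] ?_, ?_⟩
  · intro i j hij
    fin_cases i <;> fin_cases j <;> simp_all [hac.ne, had.ne, hbc.ne, hbd.ne]
  · rintro _ ⟨i, rfl⟩
    change ![a, b, c, d] i ∈ X
    fin_cases i <;> assumption

theorem HasQuad.exists_embedding {X : Set V} (h : HasQuad G X) :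
    (∃ f : C4 ↪g G, Set.range f ⊆ X) ∨ (∃ f : diamond ↪g G, Set.range f ⊆ X) ∨
      (∃ f : K4 ↪g G, Set.range f ⊆ X) := by
  obtain ⟨a, ha, b, hb, c, hc, d, hd, hq⟩ := h
  have hq' := hq
  obtain ⟨hab, hcd, hac, had, hbc, hbd⟩ := hq'
  have hm : Set.range ![a, c, b, d] ⊆ X := by
    rintro _ ⟨i, rfl⟩
    fin_cases i <;> assumption
  by_cases h₁ : G.Adj a b <;> by_cases h₂ : G.Adj c d
  · refine .inr (.inr ⟨embeddingOfAdjIff ![a, c, b, d] ?_, hm⟩)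
    intro i j hij
    fin_cases i <;> fin_cases j <;> simp_all [hac.ne, had.ne, hbc.ne.symm, hbd.ne, hbc.symm]
  -- The missing edge of `diamond` joins 0 and 1, so the nonadjacent pair `c`, `d` comes first.
  · exact .inr (.inl (exists_diamond_embedding hc hd ha hb
      ⟨hcd, hab, hac.symm, hbc.symm, had.symm, hbd.symm⟩ h₂ h₁))
  · exact .inr (.inl (exists_diamond_embedding ha hb hc hd hq h₁ h₂))
  · refine .inl ⟨embeddingOfAdjIff ![a, c, b, d] ?_, hm⟩
    intro i j hij
    have hC : ∀ i j : Fin 4, C4.Adj i j ↔ i - j = 1 ∨ j - i = 1 :=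
      fun i j => SimpleGraph.cycleGraph_adj
    rw [hC]
    fin_cases i <;> fin_cases j <;>
      first
        | exact absurd hij (by decide)
        | exact ⟨by first | exact hac.ne | exact had.ne | exact hbc.ne.symm | exact hbd.ne
                          | exact hab | exact hcd,
            iff_of_true (by first | exact hac | exact had | exact hbc.symm | exact hbd)
              (by decide)⟩
        | exact ⟨by first | exact hab | exact hcd,
            iff_of_false (by first | exact h₁ | exact h₂) (by decide)⟩

/-- Embeddings with anticomplete ranges combine to an embedding of the disjoint sum. -/
def sumEmbedding {W₁ W₂ : Type*} {H₁ : SimpleGraph W₁} {H₂ : SimpleGraph W₂} (f : H₁ ↪g G)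
    (g : H₂ ↪g G) (h : Anticomplete G (Set.range f) (Set.range g)) : H₁ ⊕g H₂ ↪g G where
  toFun := Sum.elim f g
  inj' := f.injective.sumElim g.injective fun a b => (h _ ⟨a, rfl⟩ _ ⟨b, rfl⟩).1
  map_rel_iff' := by
    rintro (a | a) (b | b)
    · simp
    · simpa using (h _ ⟨a, rfl⟩ _ ⟨b, rfl⟩).2
    · simpa using (h.symm _ ⟨a, rfl⟩ _ ⟨b, rfl⟩).2
    · simp

theorem sum_isIndContained {W₁ W₂ : Type*} {H₁ : SimpleGraph W₁} {H₂ : SimpleGraph W₂}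
    {X Y : Set V} (h : Anticomplete G X Y) {f : H₁ ↪g G} (hf : Set.range f ⊆ X)
    {g : H₂ ↪g G} (hg : Set.range g ⊆ Y) : H₁ ⊕g H₂ ⊴ G :=
  ⟨sumEmbedding f g (h.mono hf hg)⟩

theorem sum_sum_isIndContained {W₁ W₂ W₃ : Type*} {H₁ : SimpleGraph W₁} {H₂ : SimpleGraph W₂}
    {H₃ : SimpleGraph W₃} {X Y Z : Set V} (hXY : Anticomplete G X Y) (hXZ : Anticomplete G X Z)
    (hYZ : Anticomplete G Y Z) {f : H₁ ↪g G} (hf : Set.range f ⊆ X) {g : H₂ ↪g G}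
    (hg : Set.range g ⊆ Y) {k : H₃ ↪g G} (hk : Set.range k ⊆ Z) : H₁ ⊕g H₂ ⊕g H₃ ⊴ G := by
  refine ⟨sumEmbedding (sumEmbedding f g (hXY.mono hf hg)) k ?_⟩
  rintro _ ⟨a | a, rfl⟩ _ ⟨b, rfl⟩
  · exact hXZ _ (hf ⟨a, rfl⟩) _ (hk ⟨b, rfl⟩)
  · exact hYZ _ (hg ⟨a, rfl⟩) _ (hk ⟨b, rfl⟩)

theorem not_obstructed_of_familyFree (h : FamilyFree FcogBase G) (S : Set V) :
    ¬ Obstructed G S := by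
  rintro (⟨X, -, Y, -, Z, -, hX, hY, hZ, hXY, hXZ, hYZ⟩ | ⟨X, -, Y, -, hX, hY, hXY⟩)
  · have ppp := h ⟨_, P3 ⊕g P3 ⊕g P3⟩ (by simp [FcogBase])
    have ppk := h ⟨_, P3 ⊕g P3 ⊕g K3⟩ (by simp [FcogBase])
    have pkk := h ⟨_, P3 ⊕g K3 ⊕g K3⟩ (by simp [FcogBase])
    have kkk := h ⟨_, K3 ⊕g K3 ⊕g K3⟩ (by simp [FcogBase])
    -- The family lists the `P3` summands first, so mixed cases permute the three parts.
    rcases hX.exists_embedding with ⟨f, hf⟩ | ⟨f, hf⟩ <;>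
      rcases hY.exists_embedding with ⟨g, hg⟩ | ⟨g, hg⟩ <;>
      rcases hZ.exists_embedding with ⟨k, hk⟩ | ⟨k, hk⟩
    · exact ppp (sum_sum_isIndContained hXY hXZ hYZ hf hg hk)
    · exact ppk (sum_sum_isIndContained hXY hXZ hYZ hf hg hk)
    · exact ppk (sum_sum_isIndContained hXZ hXY hYZ.symm hf hk hg)
    · exact pkk (sum_sum_isIndContained hXY hXZ hYZ hf hg hk)
    · exact ppk (sum_sum_isIndContained hYZ hXY.symm hXZ.symm hg hk hf)
    · exact pkk (sum_sum_isIndContained hXY.symm hYZ hXZ hg hf hk)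
    · exact pkk (sum_sum_isIndContained hXZ.symm hYZ.symm hXY hk hf hg)
    · exact kkk (sum_sum_isIndContained hXY hXZ hYZ hf hg hk)
  · have cp := h ⟨_, C4 ⊕g P3⟩ (by simp [FcogBase])
    have ck := h ⟨_, C4 ⊕g K3⟩ (by simp [FcogBase])
    have dp := h ⟨_, diamond ⊕g P3⟩ (by simp [FcogBase])
    have dk := h ⟨_, diamond ⊕g K3⟩ (by simp [FcogBase])
    have kp := h ⟨_, K4 ⊕g P3⟩ (by simp [FcogBase])
    have kk := h ⟨_, K4 ⊕g K3⟩ (by simp [FcogBase])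
    rcases hX.exists_embedding with ⟨f, hf⟩ | ⟨f, hf⟩ | ⟨f, hf⟩ <;>
      rcases hY.exists_embedding with ⟨g, hg⟩ | ⟨g, hg⟩
    · exact cp (sum_isIndContained hXY hf hg)
    · exact ck (sum_isIndContained hXY hf hg)
    · exact dp (sum_isIndContained hXY hf hg)
    · exact dk (sum_isIndContained hXY hf hg)
    · exact kp (sum_isIndContained hXY hf hg)
    · exact kk (sum_isIndContained hXY hf hg)

theorem familyFree_Fcog_iff :
    FamilyFree Fcog G ↔ FamilyFree FcogBase G ∧ FamilyFree FcogBase Gᶜ := by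
  constructor
  · refine fun h => ⟨fun H hH => h H (.inl hH), fun H hH ⟨e⟩ => ?_⟩
    refine h ⟨H.1, H.2ᶜ⟩ (.inr ⟨H, hH, rfl⟩) ⟨?_⟩
    simpa using SimpleGraph.Embedding.complEquiv e
  · rintro ⟨h₁, h₂⟩ H (hH | ⟨J, hJ, rfl⟩) ⟨e⟩
    · exact h₁ H hH ⟨e⟩
    · refine h₂ J hJ ⟨?_⟩
      simpa using SimpleGraph.Embedding.complEquiv e

theorem familyFree_FcogBase_iff : FamilyFree FcogBase G ↔ ¬ Obstructed G Set.univ :=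
  ⟨fun h => not_obstructed_of_familyFree h _,
    fun h _ hH ⟨e⟩ => h ((obstructed_of_mem_FcogBase hH).map e)⟩

end Family

end MayaTupi

theorem mainTheorem2 {V : Type*} [Fintype V] (G : SimpleGraph V)
    (hG : MayaTupi.IsCograph G) :
    MayaTupi.IsMayaTupi G ↔ MayaTupi.FamilyFree MayaTupi.Fcog G := by
  rw [MayaTupi.isMayaTupi_iff_partitionable, MayaTupi.familyFree_Fcog_iff,
    MayaTupi.familyFree_FcogBase_iff, MayaTupi.familyFree_FcogBase_iff]
  exact ⟨fun h => ⟨MayaTupi.not_obstructed_of_partitionable h,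
      MayaTupi.not_obstructed_of_partitionable h.compl⟩,
    fun h => MayaTupi.partitionable_of_not_obstructed _ hG.hereditarilySplits h.1 h.2⟩
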